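/- Let $\Sigma$ be a finite alphabet. A timed word is a finite sequence $(t_1\cdot a_1)\cdots(t_n\cdot a_n)$ with $t_i\in\mathbb{R}_{\ge 0}$ and $a_i\in\Sigma$; a timed language is a set of timed words, and $u^{-1}L=\{w\mid uw\in L\}$. **Automata.** A timed automaton with integer resets (IRTA) is a nondeterministic timed automaton with finitely many states and transitions and finitely many clocks, all initially $0$, whose guards are conjunctions of comparisons of clocks with natural numbers, and in which every transition that resets some clock has a guard that forces $x=c$ for some clock $x$ and some $c\in\mathbb{N}$. A one-clock IRTA has a single clock $x$ and guards $\phi ::= x<m\mid m<x\mid x=m\mid\phi\wedge\phi$ $(m\in\mathbb{N})$, the guard of each resetting transition is satisfied by exactly one clock value, which is a natural number, and every timed word admits a run. **Regions and $c^K$.** Let $K\in\mathbb{N}$. For $x,y\in\mathbb{R}_{\ge 0}$ write $x\equiv^K y$ if either $\lfloor x\rfloor=\lfloor y\rfloor$ and ($\{x\}=0\Leftrightarrow\{y\}=0$), or $x>K$ and $y>K$. For a sequence of delays $d=t_1\cdots t_n$ let $0=i_0<i_1<\dots<i_p\le n$ be the longest sequence of indices such that each sum $t_{i_j+1}+\dots+t_{i_{j+1}}$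 is an integer between $0$ and $K$, and put $c^K(d)=t_{i_p+1}+\dots+t_n$. For a timed word $u$, $c^K(u)$ is $c^K$ of its sequence of delays. **Rescaling.** For $\lambda,\lambda'\in(0,1)$ let $f_{\lambda\to\lambda'}(s)=\frac{\lambda'}{\lambda}s$ for $0\le s\le\lambda$ and $f_{\lambda\to\lambda'}(s)=\lambda'+\frac{1-\lambda'}{1-\lambda}(s-\lambda)$ for $\lambda<s<1$. For $x\equiv^K x'$ define $\tau_{x\to x'}$ on finite sequences of delays by $\tau_{x\to x'}(\epsilon)=\epsilon$ and $\tau_{x\to x'}(d\,t)=d'\,t'$, where $d'=\tau_{x\to x'}(d)$ and, with $y=c^K(xd)$ and $y'=c^K(x'd')$: if $y,y'\in\mathbb{N}$ or $y,y'>K$, then $t'=t$; otherwise $\lfloor t'\rfloor=\lfloor t\rfloor$ and $\{t'\}=f_{(1-\{y\})\to(1-\{y'\})}(\{t\})$. On timed words, $\tau_{x\to x'}$ acts on the delays and keeps the letters. **Equivalences.** For a timed language $L$, write $u\approx^{L,K}v$ if $c^K(u)\equiv^K c^K(v)$ and $\tau_{c^K(u)\to c^K(v)}(u^{-1}L)=v^{-1}L$.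 An equivalence $\approx$ on timed words is $L$-preserving if $u\approx v$ implies ($u\in L\Leftrightarrow v\in L$). It is $K$-monotonic if $u\approx v$ implies that $c^K(u)\equiv^K c^K(v)$ and that, for all $a\in\Sigma$ and $t,t'\in\mathbb{R}_{\ge0}$, $c^K(u)+t\equiv^K c^K(v)+t'$ implies $u(t\cdot a)\approx v(t'\cdot a)$. It has finite index if it has finitely many classes. **Theorem.** Let $L$ be a timed language over $\Sigma$. For every $K\in\mathbb{N}$, $\approx^{L,K}$ is an equivalence relation, and: (a) $L$ is accepted by an IRTA if and only if there is a $K\in\mathbb{N}$ such that $\approx^{L,K}$ is $K$-monotonic and has finite index. The same equivalence holds with "one-clock IRTA" in place of "IRTA". (b) For every $K\in\mathbb{N}$, $\approx^{L,K}$ is coarser than every $K$-monotonic, $L$-preserving equivalence $\approx$ on timed words: $u\approx v$ implies $u\approx^{L,K}v$. -/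

import Mathlib

open scoped NNReal

noncomputable section

namespace IRTA

/-! ### Timed words -/

/-- A timed word `(t₁ · a₁) ⋯ (tₙ · aₙ)`: a finite sequence of pairs (delay, letter). -/
abbrev TimedWord (A : Type*) := List (ℝ≥0 × A)

/-- The timestamp `t₁ ⋯ tₙ` of a timed word. -/
def timestamp {A : Type*} (w : TimedWord A) : List ℝ≥0 := w.map Prod.fst

/-- The residual language `u⁻¹L = {w | uw ∈ L}`. -/
def residual {A : Type*} (L : Set (TimedWord A)) (u : TimedWord A) : Set (TimedWord A) :=
  {w | u ++ w ∈ L}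

/-! ### One-clock timed automata -/

/-- Clock constraints `φ ::= x < m | m < x | x = m | φ ∧ φ` over a single clock `x`. -/
inductive OneGuard : Type
  | lt (m : ℕ) : OneGuard
  | gt (m : ℕ) : OneGuard
  | eq (m : ℕ) : OneGuard
  | and (φ ψ : OneGuard) : OneGuard

/-- The set `⟦φ⟧` of clock values that satisfy `φ`. -/
def OneGuard.denote : OneGuard → Set ℝ≥0
  | .lt m => {x | x < m}
  | .gt m => {x | (m : ℝ≥0) < x}
  | .eq m => {x | x = m}
  | .and φ ψ => φ.denote ∩ ψ.denote

/-- A one-clock timed automaton. In a transition `(q, q', a, φ, r)`, the bit `r` is the factor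
by which the clock is multiplied: `r = 0` means that the clock is reset, `r = 1` that it is not. -/
structure OneTA (A : Type*) where
  State : Type
  finite_state : Finite State
  init : State
  trans : Set (State × State × A × OneGuard × Fin 2)
  finite_trans : trans.Finite
  final : Set State

/-- `B.Run q x w q' x'`: there is a run of `B` on `w` from the configuration `(q, x)` to the
configuration `(q', x')`. -/
inductive OneTA.Run {A : Type*} (B : OneTA A) :
    B.State → ℝ≥0 → TimedWord A → B.State → ℝ≥0 → Prop
  | nil (q : B.State) (x : ℝ≥0) : OneTA.Run B q x [] q x
  | cons {q q₁ q' : B.State} {x x' t : ℝ≥0} {a : A} {w : TimedWord A} {φ : OneGuard} {r : Fin 2} :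
      (q, q₁, a, φ, r) ∈ B.trans → x + t ∈ φ.denote →
      OneTA.Run B q₁ ((r : ℕ) * (x + t)) w q' x' →
      OneTA.Run B q x ((t, a) :: w) q' x'

/-- The language accepted from the initial configuration. -/
def OneTA.language {A : Type*} (B : OneTA A) : Set (TimedWord A) :=
  {w | ∃ q ∈ B.final, ∃ x : ℝ≥0, B.Run B.init 0 w q x}

/-- Every timed word admits a run. -/
def OneTA.Complete {A : Type*} (B : OneTA A) : Prop :=
  ∀ w : TimedWord A, ∃ (q : B.State) (x : ℝ≥0), B.Run B.init 0 w q x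

/-- Integer resets: the guard of every resetting transition amounts to `x = m`, `m ∈ ℕ`. -/
def OneTA.IntegerReset {A : Type*} (B : OneTA A) : Prop :=
  ∀ (q q' : B.State) (a : A) (φ : OneGuard), (q, q', a, φ, (0 : Fin 2)) ∈ B.trans →
    ∃ m : ℕ, φ.denote = {(m : ℝ≥0)}

/-- `L` is accepted by a complete one-clock timed automaton with integer resets. -/
def OneClockIRTADefinable {A : Type*} (L : Set (TimedWord A)) : Prop :=
  ∃ B : OneTA A, B.IntegerReset ∧ B.Complete ∧ B.language = L

/-! ### Timed automata with several clocks -/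

/-- Guards over a set `C` of clocks: conjunctions of comparisons of clocks with integers. -/
inductive Guard (C : Type) : Type
  | tt : Guard C
  | lt (x : C) (m : ℕ) : Guard C
  | le (x : C) (m : ℕ) : Guard C
  | eq (x : C) (m : ℕ) : Guard C
  | ge (x : C) (m : ℕ) : Guard C
  | gt (x : C) (m : ℕ) : Guard C
  | and (φ ψ : Guard C) : Guard C

/-- The set of clock valuations that satisfy a guard. -/
def Guard.denote {C : Type} : Guard C → Set (C → ℝ≥0)
  | .tt => Set.univ
  | .lt x m => {ν | ν x < m}
  | .le x m => {ν | ν x ≤ m}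
  | .eq x m => {ν | ν x = m}
  | .ge x m => {ν | (m : ℝ≥0) ≤ ν x}
  | .gt x m => {ν | (m : ℝ≥0) < ν x}
  | .and φ ψ => φ.denote ∩ ψ.denote

/-- A (nondeterministic) timed automaton with clocks in `C`; a transition `(q, q', a, φ, R)`
resets the clocks in `R`. -/
structure TA (A : Type*) (C : Type) where
  State : Type
  finite_state : Finite State
  init : Set State
  trans : Set (State × State × A × Guard C × Set C)
  finite_trans : trans.Finite
  final : Set State

open Classical in
/-- The valuation after the clocks in `R` have been reset. -/
def resetClocks {C : Type} (R : Set C) (ν : C → ℝ≥0) : C → ℝ≥0 :=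
  fun x => if x ∈ R then 0 else ν x

/-- `B.Run q ν w q' ν'`: there is a run of `B` on `w` from `(q, ν)` to `(q', ν')`. -/
inductive TA.Run {A : Type*} {C : Type} (B : TA A C) :
    B.State → (C → ℝ≥0) → TimedWord A → B.State → (C → ℝ≥0) → Prop
  | nil (q : B.State) (ν : C → ℝ≥0) : TA.Run B q ν [] q ν
  | cons {q q₁ q' : B.State} {ν ν' : C → ℝ≥0} {t : ℝ≥0} {a : A} {w : TimedWord A}
      {φ : Guard C} {R : Set C} :
      (q, q₁, a, φ, R) ∈ B.trans → (fun x => ν x + t) ∈ φ.denote →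
      TA.Run B q₁ (resetClocks R fun x => ν x + t) w q' ν' →
      TA.Run B q ν ((t, a) :: w) q' ν'

/-- The language accepted from the initial configurations, where all clocks are `0`. -/
def TA.language {A : Type*} {C : Type} (B : TA A C) : Set (TimedWord A) :=
  {w | ∃ q₀ ∈ B.init, ∃ q ∈ B.final, ∃ ν : C → ℝ≥0, B.Run q₀ (fun _ => 0) w q ν}

/-- Integer resets: a transition that resets some clock has a guard that forces `x = c` for some
clock `x` and some integer `c` (as it does when `x = c` is one of its conjuncts). -/
def TA.IntegerReset {A : Type*} {C : Type} (B : TA A C) : Prop :=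
  ∀ (q q' : B.State) (a : A) (φ : Guard C) (R : Set C), (q, q', a, φ, R) ∈ B.trans →
    R.Nonempty → ∃ (x : C) (c : ℕ), ∀ ν ∈ φ.denote, ν x = c

/-- `L` is accepted by a timed automaton with integer resets, with finitely many clocks. -/
def IRTADefinable {A : Type*} (L : Set (TimedWord A)) : Prop :=
  ∃ C : Type, Finite C ∧ ∃ B : TA A C, B.IntegerReset ∧ B.language = L

/-! ### Region equivalence and the value `c^K` -/

/-- The region equivalence `≡^K` on non-negative reals. -/
def RegionEq (K : ℕ) (x y : ℝ≥0) : Prop :=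
  (⌊x⌋₊ = ⌊y⌋₊ ∧ (Int.fract (x : ℝ) = 0 ↔ Int.fract (y : ℝ) = 0)) ∨
    ((K : ℝ≥0) < x ∧ (K : ℝ≥0) < y)

open Classical in
/-- `x` is replaced by `0` if it is an integer between `0` and `K`, and kept otherwise. -/
def resetAt (K : ℕ) (x : ℝ≥0) : ℝ≥0 :=
  if ∃ m : ℕ, m ≤ K ∧ x = m then 0 else x

/-- The value `c^K(d)` of a timestamp `d`: the sum of the delays after the last integral position,
where a position is integral as soon as the sum of the delays since the previous integral position
is an integer between `0` and `K`. The theorem `clock_eq_of_longest` below identifies it with the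
definition through a longest sequence of indices. -/
def clock (K : ℕ) (d : List ℝ≥0) : ℝ≥0 :=
  d.foldl (fun x t => resetAt K (x + t)) 0

/-- The value `c^K(u)` of a timed word. -/
def wordClock {A : Type*} (K : ℕ) (u : TimedWord A) : ℝ≥0 := clock K (timestamp u)

theorem clock_nil (K : ℕ) : clock K [] = 0 := rfl

theorem clock_append_singleton (K : ℕ) (d : List ℝ≥0) (t : ℝ≥0) :
    clock K (d ++ [t]) = resetAt K (clock K d + t) := by
  simp [clock]

/-- `IsIntegralSeq K d s i`: `s` is a sequence `0 = i₀ < i₁ < ⋯ < iₚ ≤ n` of indices of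
`d = t₁ ⋯ tₙ`, with last entry `i = iₚ`, such that the sum of the delays between any two
consecutive indices is an integer between `0` and `K`. -/
inductive IsIntegralSeq (K : ℕ) (d : List ℝ≥0) : List ℕ → ℕ → Prop
  | start : IsIntegralSeq K d [0] 0
  | extend {s : List ℕ} {i j : ℕ} : IsIntegralSeq K d s i → i < j → j ≤ d.length →
      (∃ m : ℕ, m ≤ K ∧ ((d.take j).drop i).sum = m) → IsIntegralSeq K d (s ++ [j]) j

theorem IsIntegralSeq.le_length {K : ℕ} {d : List ℝ≥0} {s : List ℕ} {i : ℕ}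
    (h : IsIntegralSeq K d s i) : i ≤ d.length := by
  cases h with
  | start => exact Nat.zero_le _
  | extend _ _ h _ => exact h

theorem IsIntegralSeq.length_le {K : ℕ} {d : List ℝ≥0} {s : List ℕ} {i : ℕ}
    (h : IsIntegralSeq K d s i) : s.length ≤ i + 1 := by
  induction h with
  | start => simp
  | extend _ h1 _ _ ih => simp; omega

theorem IsIntegralSeq.restrict {K : ℕ} {d : List ℝ≥0} {t : ℝ≥0} {s : List ℕ} {i : ℕ}
    (h : IsIntegralSeq K (d ++ [t]) s i) (hi : i ≤ d.length) : IsIntegralSeq K d s i := by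
  induction h with
  | start => exact .start
  | extend _ h1 _ h3 ih =>
    rw [List.take_append_of_le_length hi] at h3
    exact .extend (ih (by omega)) h1 hi h3

theorem resetAt_eq_zero {K m : ℕ} {x : ℝ≥0} (hm : m ≤ K) (hx : x = m) : resetAt K x = 0 :=
  if_pos ⟨m, hm, hx⟩

theorem IsIntegralSeq.sum_drop {K : ℕ} {d : List ℝ≥0} : ∀ {s : List ℕ} {i : ℕ},
    IsIntegralSeq K d s i → ∃ n : ℕ, (d.drop i).sum = n + clock K d := by
  induction d using List.reverseRecOn with
  | nil => intro s i _; exact ⟨0, by simp [clock]⟩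
  | append_singleton d t ih =>
    intro s i h
    by_cases hi : i ≤ d.length
    · obtain ⟨n, hn⟩ := ih (h.restrict hi)
      rw [List.drop_append_of_le_length hi, List.sum_append, hn, clock_append_singleton]
      by_cases hm : ∃ m : ℕ, m ≤ K ∧ clock K d + t = m
      · obtain ⟨m, hmK, hm⟩ := hm
        refine ⟨n + m, ?_⟩
        rw [resetAt_eq_zero hmK hm]
        simp [add_assoc, hm]
      · exact ⟨n, by simp [resetAt, if_neg hm, add_assoc]⟩
    · have hl := h.le_length
      simp only [List.length_append, List.length_singleton] at hl
      have hi' : i = d.length + 1 := by omega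
      subst hi'
      refine ⟨0, ?_⟩
      cases h with
      | @extend s' i' _ h0 h1 _ h3 =>
        obtain ⟨m, hmK, hm⟩ := h3
        have hi1 : i' ≤ d.length := by omega
        obtain ⟨n, hn⟩ := ih (h0.restrict hi1)
        rw [List.take_of_length_le (by simp), List.drop_append_of_le_length hi1,
          List.sum_append, hn] at hm
        simp only [List.sum_singleton] at hm
        have hnm : n ≤ m := by
          have : (n : ℝ≥0) ≤ m := by
            rw [← hm, add_assoc]; exact le_self_add
          exact_mod_cast this
        have hc : clock K d + t = ((m - n : ℕ) : ℝ≥0) := by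
          have h2 : (n : ℝ≥0) + (clock K d + t) = n + ((m - n : ℕ) : ℝ≥0) := by
            rw [← add_assoc, hm, ← Nat.cast_add, Nat.add_sub_cancel' hnm]
          exact add_left_cancel h2
        rw [clock_append_singleton, resetAt_eq_zero (by omega) hc]
        simp

theorem IsIntegralSeq.clock_eq {K : ℕ} {d : List ℝ≥0} : ∀ {s : List ℕ} {i : ℕ},
    IsIntegralSeq K d s i →
    (∀ j, i < j → j ≤ d.length → ¬ ∃ m : ℕ, m ≤ K ∧ ((d.take j).drop i).sum = m) →
    clock K d = (d.drop i).sum := by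
  induction d using List.reverseRecOn with
  | nil => intro s i _ _; simp [clock]
  | append_singleton d t ih =>
    intro s i h hmax
    by_cases hi : i ≤ d.length
    · have h1 := ih (h.restrict hi) (fun j h1 h2 => by
        have := hmax j h1 (by simp; omega)
        rwa [List.take_append_of_le_length h2] at this)
      have h2 := hmax (d.length + 1) (by omega) (by simp)
      rw [List.take_of_length_le (by simp), List.drop_append_of_le_length hi, List.sum_append,
        ← h1, List.sum_singleton] at h2
      rw [clock_append_singleton, List.drop_append_of_le_length hi, List.sum_append, ← h1,
        List.sum_singleton, resetAt, if_neg h2]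
    · have hl := h.le_length
      obtain ⟨n, hn⟩ := h.sum_drop
      rw [List.drop_of_length_le (by simp at hl ⊢; omega), List.sum_nil] at hn ⊢
      exact (add_eq_zero.1 hn.symm).2

/-- A longest sequence of integral positions exists, and for every such sequence `c^K(d)` is the
sum of the delays after its last entry. -/
theorem clock_eq_of_longest (K : ℕ) (d : List ℝ≥0) :
    (∃ s i, IsIntegralSeq K d s i ∧
      ∀ s' i', IsIntegralSeq K d s' i' → s'.length ≤ s.length) ∧
    ∀ s i, IsIntegralSeq K d s i →
      (∀ s' i', IsIntegralSeq K d s' i' → s'.length ≤ s.length) →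
      clock K d = (d.drop i).sum := by
  constructor
  · classical
    let P : ℕ → Prop := fun n => ∃ s i, IsIntegralSeq K d s i ∧ s.length = n
    have hb : ∀ n, P n → n ≤ d.length + 1 := by
      rintro n ⟨s, i, h, rfl⟩
      have := h.length_le
      have := h.le_length
      omega
    have h1 : P 1 := ⟨[0], 0, .start, rfl⟩
    obtain ⟨s, i, h, hs⟩ := Nat.findGreatest_spec (P := P) (hb 1 h1) h1
    refine ⟨s, i, h, fun s' i' h' => ?_⟩
    rw [hs]
    exact Nat.le_findGreatest (hb _ ⟨s', i', h', rfl⟩) ⟨s', i', h', rfl⟩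
  · intro s i h hmax
    refine h.clock_eq fun j h1 h2 h3 => ?_
    have := hmax _ _ (h.extend h1 h2 h3)
    simp at this

/-! ### The rescaling functions -/

/-- The bijection `f_{l → l'}` that scales `(0, l]` to `(0, l']` and `(l, 1)` to `(l', 1)`.
The first formula also covers `t = 0`, with value `0`. -/
def scale (l l' t : ℝ) : ℝ :=
  if t ≤ l then l' / l * t else l' + (1 - l') / (1 - l) * (t - l)

open Classical in
/-- The new delay `t'` of a delay `t`, for the current clock values `y` and `y'`: it is `t` if
`y, y'` are both integers or both greater than `K`; otherwise it has the same integral part as `t`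
and its fractional part is `f_{1 - {y} → 1 - {y'}}({t})`. -/
def rescaleDelay (K : ℕ) (y y' t : ℝ≥0) : ℝ≥0 :=
  if ((∃ n : ℕ, y = n) ∧ ∃ n : ℕ, y' = n) ∨ ((K : ℝ≥0) < y ∧ (K : ℝ≥0) < y') then t
  else ⌊t⌋₊ +
    (scale (1 - Int.fract (y : ℝ)) (1 - Int.fract (y' : ℝ)) (Int.fract (t : ℝ))).toNNReal

/-- The delays of a timestamp are rescaled from left to right, for current clock values `y`
and `y'`. -/
def rescaleFrom (K : ℕ) : ℝ≥0 → ℝ≥0 → List ℝ≥0 → List ℝ≥0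
  | _, _, [] => []
  | y, y', t :: d =>
    rescaleDelay K y y' t ::
      rescaleFrom K (resetAt K (y + t)) (resetAt K (y' + rescaleDelay K y y' t)) d

/-- The rescaling function `τ_{x → x'}` on timestamps. -/
def rescale (K : ℕ) (x x' : ℝ≥0) (d : List ℝ≥0) : List ℝ≥0 :=
  rescaleFrom K (clock K [x]) (clock K [x']) d

/-- The rescaling function `τ_{x → x'}` on timed words: the letters are kept. -/
def rescaleWord {A : Type*} (K : ℕ) (x x' : ℝ≥0) (w : TimedWord A) : TimedWord A :=
  (rescale K x x' (timestamp w)).zip (w.map Prod.snd)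

theorem rescale_nil (K : ℕ) (x x' : ℝ≥0) : rescale K x x' [] = [] := rfl

theorem rescaleFrom_append_singleton (K : ℕ) (d : List ℝ≥0) (t : ℝ≥0) : ∀ y y' : ℝ≥0,
    rescaleFrom K y y' (d ++ [t]) = rescaleFrom K y y' d ++
      [rescaleDelay K (d.foldl (fun x t => resetAt K (x + t)) y)
        ((rescaleFrom K y y' d).foldl (fun x t => resetAt K (x + t)) y') t] := by
  induction d with
  | nil => intro y y'; simp [rescaleFrom]
  | cons s d ih => intro y y'; simp [rescaleFrom, ih]

/-- The defining recursion `τ_{x → x'}(dt) = d't'` with `d' = τ_{x → x'}(d)`, where `t'` is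
determined by `t`, `y = c^K(xd)` and `y' = c^K(x'd')`. -/
theorem rescale_append_singleton (K : ℕ) (x x' : ℝ≥0) (d : List ℝ≥0) (t : ℝ≥0) :
    rescale K x x' (d ++ [t]) = rescale K x x' d ++
      [rescaleDelay K (clock K (x :: d)) (clock K (x' :: rescale K x x' d)) t] := by
  simp [rescale, rescaleFrom_append_singleton, clock]

/-- The rescaled fractional part is in `[0, 1)`, so that no truncation takes place in
`rescaleDelay`. -/
theorem scale_mem_Ico {l l' t : ℝ} (hl : 0 < l) (hl' : 0 < l') (hl1 : l' < 1)
    (ht : 0 ≤ t) (ht1 : t < 1) : scale l l' t ∈ Set.Ico (0 : ℝ) 1 := by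
  unfold scale
  split_ifs with h
  · refine ⟨by positivity, ?_⟩
    have : l' / l * t ≤ l' := by
      rw [div_mul_eq_mul_div, div_le_iff₀ hl]
      exact mul_le_mul_of_nonneg_left h hl'.le
    linarith
  · push Not at h
    have h1 : 0 < 1 - l := by linarith
    have h2 : 0 < 1 - l' := by linarith
    have h3 : 0 < t - l := by linarith
    refine ⟨by positivity, ?_⟩
    have : (1 - l') / (1 - l) * (t - l) < 1 - l' := by
      rw [div_mul_eq_mul_div, div_lt_iff₀ h1]
      exact mul_lt_mul_of_pos_left (by linarith) h2
    linarith

/-! ### Equivalences on timed words -/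

/-- `r` is `L`-preserving. -/
def LPreserving {A : Type*} (L : Set (TimedWord A)) (r : TimedWord A → TimedWord A → Prop) :
    Prop :=
  ∀ u v, r u v → (u ∈ L ↔ v ∈ L)

/-- `r` is `K`-monotonic. -/
def KMonotonic {A : Type*} (K : ℕ) (r : TimedWord A → TimedWord A → Prop) : Prop :=
  ∀ u v, r u v →
    RegionEq K (wordClock K u) (wordClock K v) ∧
    ∀ (a : A) (t t' : ℝ≥0), RegionEq K (wordClock K u + t) (wordClock K v + t') →
      r (u ++ [(t, a)]) (v ++ [(t', a)])

/-- `r` has finite index: the set of its classes is finite. -/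
def FiniteIndex {S : Type*} (r : S → S → Prop) : Prop :=
  (Set.range fun s : S => {s' : S | r s s'}).Finite

/-- The syntactic equivalence `≈^{L,K}`. -/
def SyntacticEquiv {A : Type*} (L : Set (TimedWord A)) (K : ℕ) (u v : TimedWord A) : Prop :=
  RegionEq K (wordClock K u) (wordClock K v) ∧
    rescaleWord K (wordClock K u) (wordClock K v) '' residual L u = residual L v

end IRTA

end

open scoped NNReal

noncomputable section

namespace IRTA

/-! ### Regions -/

/-! The proof rests on two facts about rescaling. If `y ≡^K y'`, a delay `t` and its rescaled
version lead from `y` and `y'` into the same region (`RegionEq.add_rescaleDelay`), because the break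
point of the scaling is the moment at which the next integer is reached. Rescalings also compose, `y
→ y' → y''` giving `y → y''`, and `y → y` is the identity (`rescaleWordFrom_rescaleWordFrom`,
`rescaleWordFrom_self`). Hence rescalings are bijections and `≈^{L,K}` is an equivalence. A
`K`-monotonic relation can be pushed along a word and its rescaling letter by letter, which together
with `L`-preservation gives (b).

From automata to equivalences: when `K` bounds all constants, every clock differs from `c^K(u)` by a
natural number throughout a run. Indeed a reset needs some clock to be an integer at most `K`; then
the current value of `c^K` is such an integer too and drops to `0` at the same moment
(`TA.BoundedBy.step`). Offsets matter only up to `K + 1`, so "same region of `c^K`, same reachable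
pairs of state and capped offsets" is a `K`-monotonic, `L`-preserving equivalence of finite index.
By (b), `≈^{L,K}` is coarser; it therefore has finite index, and it inherits monotonicity
(`KMonotonic.kMonotonic_syntacticEquiv`).

Conversely, the classes of a monotonic `≈^{L,K}` of finite index are the states of a one-clock
automaton whose clock follows `c^K` (`syntacticTA_run_iff`). As one-clock automata are special
automata with several clocks, all the conditions are equivalent. -/

theorem exists_natCast_add (t : ℝ≥0) : ∃ (k : ℕ) (s : ℝ), 0 ≤ s ∧ s < 1 ∧ (t : ℝ) = k + s := by
  have h1 : (⌊t⌋₊ : ℝ≥0) ≤ t := Nat.floor_le zero_le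
  have h2 : t < (⌊t⌋₊ : ℝ≥0) + 1 := Nat.lt_floor_add_one t
  rw [← NNReal.coe_le_coe] at h1
  rw [← NNReal.coe_lt_coe] at h2
  push_cast at h1 h2
  exact ⟨⌊t⌋₊, t - ⌊t⌋₊, by linarith, by linarith, by ring⟩

theorem fract_eq_zero_iff_eq_floor (x : ℝ≥0) : Int.fract (x : ℝ) = 0 ↔ x = (⌊x⌋₊ : ℝ≥0) := by
  obtain ⟨k, s, hs, hs1, hx⟩ := exists_natCast_add x
  have hfl : ⌊x⌋₊ = k := by
    rw [Nat.floor_eq_iff zero_le, ← NNReal.coe_le_coe, ← NNReal.coe_lt_coe]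
    push_cast
    constructor <;> linarith
  rw [hfl, ← NNReal.coe_inj, NNReal.coe_natCast, hx, Int.fract_natCast_add,
    Int.fract_eq_self.2 ⟨hs, hs1⟩, add_eq_left]

/-- Regions are what comparisons with the integers up to `K` can see. In this form symmetry,
transitivity and the invariance of guards are immediate. -/
theorem regionEq_iff {K : ℕ} {x y : ℝ≥0} :
    RegionEq K x y ↔ ∀ m : ℕ, m ≤ K → (x < m ↔ y < m) ∧ ((m : ℝ≥0) < x ↔ (m : ℝ≥0) < y) := by
  rw [RegionEq, fract_eq_zero_iff_eq_floor, fract_eq_zero_iff_eq_floor]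
  constructor
  · rintro (⟨h1, h2⟩ | ⟨hx, hy⟩) m hm
    · have hlt : x < m ↔ y < m := by
        rw [← Nat.floor_lt zero_le, ← Nat.floor_lt zero_le, h1]
      have heq : x = m ↔ y = m := by
        constructor
        · rintro rfl
          rw [Nat.floor_natCast] at h1 h2
          rw [h1]
          exact h2.1 rfl
        · rintro rfl
          rw [Nat.floor_natCast] at h1 h2
          rw [← h1]
          exact h2.2 rfl
      refine ⟨hlt, ?_⟩
      rw [← not_le, ← not_le, le_iff_lt_or_eq, le_iff_lt_or_eq, hlt, heq]
    · have hK : (m : ℝ≥0) ≤ K := by exact_mod_cast hm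
      have h1 := hK.trans_lt hx
      have h2 := hK.trans_lt hy
      simp [h1, h2, h1.not_gt, h2.not_gt]
  · intro h
    by_cases hx : (K : ℝ≥0) < x
    · exact Or.inr ⟨hx, (h K le_rfl).2.1 hx⟩
    · left
      have hy : ¬ (K : ℝ≥0) < y := fun hy => hx ((h K le_rfl).2.2 hy)
      push Not at hx hy
      have hfx : ⌊x⌋₊ ≤ K := by
        have := Nat.floor_le_floor hx
        rwa [Nat.floor_natCast] at this
      have hfl : ⌊x⌋₊ = ⌊y⌋₊ := by
        symm
        rw [Nat.floor_eq_iff zero_le]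
        constructor
        · rw [← not_lt, ← (h _ hfx).1, not_lt]
          exact Nat.floor_le zero_le
        · rcases hfx.lt_or_eq with hlt | heq
          · have := (h (⌊x⌋₊ + 1) hlt).1.1 (by push_cast; exact Nat.lt_floor_add_one x)
            exact_mod_cast this
          · rw [heq]
            exact hy.trans_lt (lt_add_one _)
      refine ⟨hfl, ?_⟩
      have hx' : x = (⌊x⌋₊ : ℝ≥0) ↔ ¬ (⌊x⌋₊ : ℝ≥0) < x :=
        ⟨fun h => h.not_gt, fun h => le_antisymm (not_lt.1 h) (Nat.floor_le zero_le)⟩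
      have hy' : y = (⌊y⌋₊ : ℝ≥0) ↔ ¬ (⌊y⌋₊ : ℝ≥0) < y :=
        ⟨fun h => h.not_gt, fun h => le_antisymm (not_lt.1 h) (Nat.floor_le zero_le)⟩
      rw [hx', hy', ← hfl, (h _ hfx).2]

theorem RegionEq.refl (K : ℕ) (x : ℝ≥0) : RegionEq K x x :=
  Or.inl ⟨rfl, Iff.rfl⟩

theorem RegionEq.symm {K : ℕ} {x y : ℝ≥0} (h : RegionEq K x y) : RegionEq K y x := by
  rw [regionEq_iff] at *
  exact fun m hm => ⟨(h m hm).1.symm, (h m hm).2.symm⟩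

theorem RegionEq.trans {K : ℕ} {x y z : ℝ≥0} (h : RegionEq K x y) (h' : RegionEq K y z) :
    RegionEq K x z := by
  rw [regionEq_iff] at *
  exact fun m hm => ⟨(h m hm).1.trans (h' m hm).1, (h m hm).2.trans (h' m hm).2⟩

theorem RegionEq.lt_iff {K m : ℕ} {x y : ℝ≥0} (h : RegionEq K x y) (hm : m ≤ K) :
    x < m ↔ y < m :=
  (regionEq_iff.1 h m hm).1

theorem RegionEq.gt_iff {K m : ℕ} {x y : ℝ≥0} (h : RegionEq K x y) (hm : m ≤ K) :
    (m : ℝ≥0) < x ↔ (m : ℝ≥0) < y :=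
  (regionEq_iff.1 h m hm).2

theorem RegionEq.le_iff {K m : ℕ} {x y : ℝ≥0} (h : RegionEq K x y) (hm : m ≤ K) :
    x ≤ m ↔ y ≤ m := by
  rw [← not_lt, ← not_lt, h.gt_iff hm]

theorem RegionEq.ge_iff {K m : ℕ} {x y : ℝ≥0} (h : RegionEq K x y) (hm : m ≤ K) :
    (m : ℝ≥0) ≤ x ↔ (m : ℝ≥0) ≤ y := by
  rw [← not_lt, ← not_lt, h.lt_iff hm]

theorem RegionEq.eq_iff {K m : ℕ} {x y : ℝ≥0} (h : RegionEq K x y) (hm : m ≤ K) :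
    x = m ↔ y = m := by
  rw [le_antisymm_iff, le_antisymm_iff, h.le_iff hm, h.ge_iff hm]

/-- Offsets above `K` push both values beyond `K`, so only their values capped at `K + 1` matter;
smaller offsets must coincide and merely shift the integers of comparison. -/
theorem RegionEq.add_natCast {K n n' : ℕ} {x y : ℝ≥0} (h : RegionEq K x y)
    (hn : min n (K + 1) = min n' (K + 1)) : RegionEq K (x + n) (y + n') := by
  rw [regionEq_iff]
  intro m hm
  by_cases hnK : n ≤ K
  · obtain rfl : n = n' := by omega
    rcases le_or_gt n m with hnm | hnm
    · obtain ⟨k, rfl⟩ := Nat.exists_eq_add_of_le' hnm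
      have := regionEq_iff.1 h k (by omega)
      simpa using this
    · have h1 : (m : ℝ≥0) < n := by exact_mod_cast hnm
      have hx : (m : ℝ≥0) < x + n := h1.trans_le le_add_self
      have hy : (m : ℝ≥0) < y + n := h1.trans_le le_add_self
      simp [hx, hy, hx.not_gt, hy.not_gt]
  · have h1 : (m : ℝ≥0) < n := by exact_mod_cast (by omega : m < n)
    have h2 : (m : ℝ≥0) < n' := by exact_mod_cast (by omega : m < n')
    have hx : (m : ℝ≥0) < x + n := h1.trans_le le_add_self
    have hy : (m : ℝ≥0) < y + n' := h2.trans_le le_add_self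
    simp [hx, hy, hx.not_gt, hy.not_gt]

theorem RegionEq.resetAt {K : ℕ} {x y : ℝ≥0} (h : RegionEq K x y) :
    RegionEq K (resetAt K x) (resetAt K y) := by
  have hiff : (∃ m : ℕ, m ≤ K ∧ x = m) ↔ ∃ m : ℕ, m ≤ K ∧ y = m :=
    exists_congr fun m => and_congr_right fun hm => h.eq_iff hm
  unfold IRTA.resetAt
  split_ifs with h1 h2 h2
  · exact .refl _ _
  · exact absurd (hiff.1 h1) h2
  · exact absurd (hiff.2 h2) h1
  · exact h

theorem resetAt_resetAt (K : ℕ) (x : ℝ≥0) : resetAt K (resetAt K x) = resetAt K x := by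
  by_cases h : ∃ m : ℕ, m ≤ K ∧ x = m
  · obtain ⟨m, hm, hx⟩ := h
    rw [resetAt_eq_zero hm hx, resetAt_eq_zero (Nat.zero_le K) Nat.cast_zero.symm]
  · have : resetAt K x = x := if_neg h
    rw [this, this]

/-! ### Clock values of timed words -/

theorem wordClock_nil {A : Type*} (K : ℕ) : wordClock K ([] : TimedWord A) = 0 := rfl

theorem wordClock_append_singleton {A : Type*} (K : ℕ) (u : TimedWord A) (t : ℝ≥0) (a : A) :
    wordClock K (u ++ [(t, a)]) = resetAt K (wordClock K u + t) := by
  simp [wordClock, timestamp, clock_append_singleton]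

theorem resetAt_wordClock {A : Type*} (K : ℕ) (u : TimedWord A) :
    resetAt K (wordClock K u) = wordClock K u := by
  induction u using List.reverseRecOn with
  | nil => exact resetAt_eq_zero (Nat.zero_le K) Nat.cast_zero.symm
  | append_singleton u p _ => rw [wordClock_append_singleton, resetAt_resetAt]

/-! ### Rescaling of a delay -/

theorem scale_self {l t : ℝ} (hl : 0 < l) (hl1 : l < 1) : scale l l t = t := by
  have h1 : 1 - l ≠ 0 := by linarith
  unfold scale
  split_ifs
  · field_simp
  · field_simp; ring

/-- With `l = 1 - {y}`, the condition `t ≤ l` says that the fractional part of the delay does not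
carry the clock past an additional integer. -/
theorem scale_le_iff {l l' t : ℝ} (hl : 0 < l) (hl1 : l < 1) (hl' : 0 < l') (hl1' : l' < 1) :
    scale l l' t ≤ l' ↔ t ≤ l := by
  unfold scale
  split_ifs with h
  · refine ⟨fun _ => h, fun _ => ?_⟩
    rw [div_mul_eq_mul_div, div_le_iff₀ hl]
    exact mul_le_mul_of_nonneg_left h hl'.le
  · refine ⟨fun h2 => absurd h2 ?_, fun h2 => absurd h2 h⟩
    push Not at h ⊢
    have h1 : 0 < (1 - l') / (1 - l) * (t - l) :=
      mul_pos (div_pos (by linarith) (by linarith)) (by linarith)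
    linarith

theorem scale_eq_iff {l l' t : ℝ} (hl : 0 < l) (hl1 : l < 1) (hl' : 0 < l') (hl1' : l' < 1) :
    scale l l' t = l' ↔ t = l := by
  constructor
  · intro h
    have h1 := (scale_le_iff hl hl1 hl' hl1').1 h.le
    rw [scale, if_pos h1, div_mul_eq_mul_div, div_eq_iff hl.ne'] at h
    exact mul_left_cancel₀ hl'.ne' h
  · rintro rfl
    rw [scale, if_pos le_rfl, div_mul_cancel₀ _ hl.ne']

/-- The first map sends the break point `l` to the break point `l'` of the second, so the linear
pieces match and their slopes multiply. -/
theorem scale_scale {l l' l'' t : ℝ} (hl : 0 < l) (hl1 : l < 1) (hl' : 0 < l') (hl1' : l' < 1) :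
    scale l' l'' (scale l l' t) = scale l l'' t := by
  have h1 : 1 - l ≠ 0 := by linarith
  have h2 : 1 - l' ≠ 0 := by linarith
  by_cases h : t ≤ l
  · rw [scale, if_pos ((scale_le_iff hl hl1 hl' hl1').2 h), scale, if_pos h, scale, if_pos h]
    field_simp
  · rw [scale, if_neg (mt (scale_le_iff hl hl1 hl' hl1').1 h), scale, if_neg h, scale, if_neg h]
    field_simp
    ring

/-- Clock values in the same region are both integers, both larger than `K`, or both in the same
open unit interval. -/
theorem RegionEq.cases {K : ℕ} {y y' : ℝ≥0} (h : RegionEq K y y') :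
    (∃ n : ℕ, n ≤ K ∧ y = n ∧ y' = n) ∨ ((K : ℝ≥0) < y ∧ (K : ℝ≥0) < y') ∨
    ∃ (m : ℕ) (f f' : ℝ), 0 < f ∧ f < 1 ∧ 0 < f' ∧ f' < 1 ∧ (y : ℝ) = m + f ∧ (y' : ℝ) = m + f' ∧
      y ≤ K ∧ y' ≤ K := by
  by_cases hK : (K : ℝ≥0) < y
  · exact Or.inr (Or.inl ⟨hK, (h.gt_iff le_rfl).1 hK⟩)
  have hK' : ¬ (K : ℝ≥0) < y' := fun h' => hK ((h.gt_iff le_rfl).2 h')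
  by_cases hn : ∃ n : ℕ, n ≤ K ∧ y = n
  · obtain ⟨n, hn, hy⟩ := hn
    exact Or.inl ⟨n, hn, hy, (h.eq_iff hn).1 hy⟩
  right; right
  push Not at hK hK'
  have hfK : ⌊y⌋₊ ≤ K := by
    have := Nat.floor_le_floor hK
    rwa [Nat.floor_natCast] at this
  have hne : y ≠ ⌊y⌋₊ := fun h => hn ⟨_, hfK, h⟩
  have h1 : (⌊y⌋₊ : ℝ≥0) < y := lt_of_le_of_ne (Nat.floor_le zero_le) hne.symm
  have h2 : y < (⌊y⌋₊ + 1 : ℕ) := by push_cast; exact Nat.lt_floor_add_one y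
  have h3 : ⌊y⌋₊ + 1 ≤ K := by
    have : (⌊y⌋₊ : ℝ≥0) < K := h1.trans_le hK
    exact_mod_cast this
  have h1' := (h.gt_iff hfK).1 h1
  have h2' := (h.lt_iff h3).1 h2
  rw [← NNReal.coe_lt_coe] at h1 h2 h1' h2'
  push_cast at h1 h2 h1' h2'
  exact ⟨⌊y⌋₊, y - ⌊y⌋₊, y' - ⌊y⌋₊, by linarith, by linarith, by linarith, by linarith, by ring,
    by ring, hK, hK'⟩

theorem not_exists_eq_natCast {m : ℕ} {f : ℝ} {y : ℝ≥0} (hf : 0 < f) (hf1 : f < 1)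
    (hy : (y : ℝ) = m + f) : ¬ ∃ n : ℕ, y = n := by
  rintro ⟨n, rfl⟩
  rw [NNReal.coe_natCast] at hy
  have h1 : (m : ℝ) < n := by linarith
  have h2 : (n : ℝ) < m + 1 := by linarith
  norm_cast at h1 h2
  omega

theorem rescaleDelay_of_natCast {K n : ℕ} {y y' : ℝ≥0} (hy : y = n) (hy' : y' = n) (t : ℝ≥0) :
    rescaleDelay K y y' t = t :=
  if_pos (Or.inl ⟨⟨n, hy⟩, ⟨n, hy'⟩⟩)

theorem rescaleDelay_of_lt {K : ℕ} {y y' : ℝ≥0} (hy : (K : ℝ≥0) < y) (hy' : (K : ℝ≥0) < y')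
    (t : ℝ≥0) : rescaleDelay K y y' t = t :=
  if_pos (Or.inr ⟨hy, hy'⟩)

theorem coe_rescaleDelay {K m : ℕ} {f f' s : ℝ} {y y' t : ℝ≥0} {k : ℕ} (hf : 0 < f) (hf1 : f < 1)
    (hf' : 0 < f') (hf1' : f' < 1) (hy : (y : ℝ) = m + f) (hy' : (y' : ℝ) = m + f')
    (hyK : y ≤ K) (hs : 0 ≤ s) (hs1 : s < 1) (ht : (t : ℝ) = k + s) :
    (rescaleDelay K y y' t : ℝ) = k + scale (1 - f) (1 - f') s := by
  have hfl : ⌊t⌋₊ = k := by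
    rw [Nat.floor_eq_iff zero_le, ← NNReal.coe_le_coe, ← NNReal.coe_lt_coe]
    push_cast
    constructor <;> linarith
  have hfr : ∀ {z g : ℝ} {n : ℕ}, 0 ≤ g → g < 1 → z = n + g → Int.fract z = g := by
    rintro z g n hg hg1 rfl
    rw [Int.fract_natCast_add, Int.fract_eq_self.2 ⟨hg, hg1⟩]
  rw [rescaleDelay, if_neg, hfr hf.le hf1 hy, hfr hf'.le hf1' hy', hfr hs hs1 ht, hfl,
    NNReal.coe_add, NNReal.coe_natCast, Real.coe_toNNReal]
  · exact (scale_mem_Ico (by linarith) (by linarith) (by linarith) hs hs1).1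
  · rintro (⟨h, -⟩ | ⟨h, -⟩)
    · exact not_exists_eq_natCast hf hf1 hy h
    · exact hyK.not_gt h

theorem rescaleDelay_self (K : ℕ) (y t : ℝ≥0) : rescaleDelay K y y t = t := by
  rcases (RegionEq.refl K y).cases with ⟨n, -, hy, -⟩ | ⟨hy, -⟩ |
    ⟨m, f, f', hf, hf1, -, -, hy, -, hK, -⟩
  · exact rescaleDelay_of_natCast hy hy t
  · exact rescaleDelay_of_lt hy hy t
  · obtain ⟨k, s, hs, hs1, ht⟩ := exists_natCast_add t
    rw [← NNReal.coe_inj, coe_rescaleDelay hf hf1 hf hf1 hy hy hK hs hs1 ht,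
      scale_self (by linarith) (by linarith), ht]

theorem rescaleDelay_rescaleDelay {K : ℕ} {y y' y'' : ℝ≥0} (h : RegionEq K y y')
    (h' : RegionEq K y' y'') (t : ℝ≥0) :
    rescaleDelay K y' y'' (rescaleDelay K y y' t) = rescaleDelay K y y'' t := by
  rcases h.cases with ⟨n, hn, hy, hy'⟩ | ⟨hy, hy'⟩ | ⟨m, f, f', hf, hf1, hf', hf1', hy, hy', hK, hK'⟩
  · have hy'' := (h'.eq_iff hn).1 hy'
    simp only [rescaleDelay_of_natCast hy hy', rescaleDelay_of_natCast hy' hy'',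
      rescaleDelay_of_natCast hy hy'']
  · have hy'' := (h'.gt_iff le_rfl).1 hy'
    simp only [rescaleDelay_of_lt hy hy', rescaleDelay_of_lt hy' hy'', rescaleDelay_of_lt hy hy'']
  · rcases h'.cases with ⟨n, -, hn, -⟩ | ⟨hn, -⟩ | ⟨m₁, g, g', hg, hg1, hg', hg1', hz, hz', -, -⟩
    · exact absurd ⟨n, hn⟩ (not_exists_eq_natCast hf' hf1' hy')
    · exact absurd hn hK'.not_gt
    -- Both decompositions describe `y'`, so their integral and fractional parts agree.
    · obtain rfl : m₁ = m := by
        have h1 : (m₁ : ℝ) < m + 1 := by linarith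
        have h2 : (m : ℝ) < m₁ + 1 := by linarith
        norm_cast at h1 h2
        omega
      obtain rfl : g = f' := by linarith
      obtain ⟨k, s, hs, hs1, ht⟩ := exists_natCast_add t
      have hsc := scale_mem_Ico (l := 1 - f) (l' := 1 - g) (by linarith) (by linarith)
        (by linarith) hs hs1
      have h1 := coe_rescaleDelay hf hf1 hf' hf1' hy hy' hK hs hs1 ht
      rw [← NNReal.coe_inj,
        coe_rescaleDelay hf' hf1' hg' hg1' hy' hz' hK' hsc.1 hsc.2 h1,
        coe_rescaleDelay hf hf1 hg' hg1' hy hz' hK hs hs1 ht,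
        scale_scale (by linarith) (by linarith) (by linarith) (by linarith)]

/-- The integers passed during the delay are the same on both sides: integral parts agree, and the
scaling preserves the position of the fractional part relative to the distance to the next integer.
-/
theorem RegionEq.add_rescaleDelay {K : ℕ} {y y' : ℝ≥0} (h : RegionEq K y y') (t : ℝ≥0) :
    RegionEq K (y + t) (y' + rescaleDelay K y y' t) := by
  rcases h.cases with ⟨n, hn, hy, hy'⟩ | ⟨hy, hy'⟩ | ⟨m, f, f', hf, hf1, hf', hf1', hy, hy', hK, hK'⟩
  · rw [rescaleDelay_of_natCast hy hy', hy, hy']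
    exact .refl _ _
  · rw [rescaleDelay_of_lt hy hy']
    exact Or.inr ⟨hy.trans_le le_self_add, hy'.trans_le le_self_add⟩
  · obtain ⟨k, s, hs, hs1, ht⟩ := exists_natCast_add t
    have hsc := scale_mem_Ico (l := 1 - f) (l' := 1 - f') (by linarith) (by linarith)
      (by linarith) hs hs1
    have h1 := coe_rescaleDelay hf hf1 hf' hf1' hy hy' hK hs hs1 ht
    have hle := scale_le_iff (l := 1 - f) (l' := 1 - f') (t := s) (by linarith) (by linarith)
      (by linarith) (by linarith)
    have heq := scale_eq_iff (l := 1 - f) (l' := 1 - f') (t := s) (by linarith) (by linarith)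
      (by linarith) (by linarith)
    rw [regionEq_iff]
    intro j _
    simp only [← NNReal.coe_lt_coe, NNReal.coe_add, NNReal.coe_natCast, h1, hy, hy', ht]
    generalize scale (1 - f) (1 - f') s = s' at *
    obtain ⟨hs0', hs1'⟩ := hsc
    -- The value lies strictly between `m + k` and `m + k + 2`, so only the comparison with `m + k +
    -- 1` depends on `g` and `r`, and it amounts to comparing `r` with `1 - g`.
    have key : ∀ {g r : ℝ}, 0 < g → g < 1 → 0 ≤ r → r < 1 →
        ((m + g + (k + r) < (j : ℝ) ↔ m + k + 2 ≤ j ∨ (m + k + 1 = j ∧ r ≤ 1 - g ∧ r ≠ 1 - g)) ∧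
        ((j : ℝ) < m + g + (k + r) ↔ j ≤ m + k ∨ (m + k + 1 = j ∧ ¬ r ≤ 1 - g))) := by
      intro g r hg hg1 hr hr1
      rcases lt_trichotomy j (m + k + 1) with hj | hj | hj
      · have hj' : (j : ℝ) ≤ m + k := by exact_mod_cast Nat.le_of_lt_succ hj
        have e1 : ¬ m + k + 2 ≤ j := by omega
        have e2 : ¬ m + k + 1 = j := by omega
        have e3 : j ≤ m + k := by omega
        simp only [e1, e2, e3, false_and, or_false, iff_false, iff_true, not_lt]
        constructor <;> linarith
      · subst hj
        have e1 : ¬ m + k + 2 ≤ m + k + 1 := by omega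
        have e3 : ¬ m + k + 1 ≤ m + k := by omega
        simp only [e1, e3, true_and, false_or]
        push_cast
        refine ⟨⟨fun h => ⟨by linarith, by intro h'; linarith⟩, fun ⟨h, h'⟩ => ?_⟩,
          ⟨fun h => by linarith, fun h => by linarith⟩⟩
        have := lt_of_le_of_ne h h'
        linarith
      · have hj' : (m : ℝ) + k + 2 ≤ j := by exact_mod_cast hj
        have e1 : m + k + 2 ≤ j := hj
        have e2 : ¬ m + k + 1 = j := by omega
        have e3 : ¬ j ≤ m + k := by omega
        simp only [e1, e2, e3, false_and, or_false, iff_true, iff_false, not_lt]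
        constructor <;> linarith
    rw [(key hf hf1 hs hs1).1, (key hf hf1 hs hs1).2, (key hf' hf1' hs0' hs1').1,
      (key hf' hf1' hs0' hs1').2, hle, Ne, Ne, heq]
    exact ⟨Iff.rfl, Iff.rfl⟩

/-! ### Rescaling of timed words -/

/-- The rescaling function on timed words, for current clock values `y` and `y'`. -/
def rescaleWordFrom {A : Type*} (K : ℕ) : ℝ≥0 → ℝ≥0 → TimedWord A → TimedWord A
  | _, _, [] => []
  | y, y', (t, a) :: w =>
    (rescaleDelay K y y' t, a) ::
      rescaleWordFrom K (resetAt K (y + t)) (resetAt K (y' + rescaleDelay K y y' t)) w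

theorem rescaleFrom_zip {A : Type*} (K : ℕ) (w : TimedWord A) (y y' : ℝ≥0) :
    (rescaleFrom K y y' (timestamp w)).zip (w.map Prod.snd) = rescaleWordFrom K y y' w := by
  induction w generalizing y y' with
  | nil => rfl
  | cons p w ih =>
    obtain ⟨t, a⟩ := p
    simp only [timestamp, List.map_cons, rescaleFrom, List.zip_cons_cons, rescaleWordFrom]
    rw [← ih]
    rfl

/-- `rescale` starts from `clock K [x]`, that is from `resetAt K x`; values of `c^K` are fixed
points of `resetAt`, so this initial reset has no effect. -/
theorem rescaleWord_wordClock {A : Type*} (K : ℕ) (u v w : TimedWord A) :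
    rescaleWord K (wordClock K u) (wordClock K v) w =
      rescaleWordFrom K (wordClock K u) (wordClock K v) w := by
  have h : ∀ u : TimedWord A, clock K [wordClock K u] = wordClock K u := fun u => by
    simp [clock, resetAt_wordClock]
  rw [rescaleWord, rescale, h, h, rescaleFrom_zip]

theorem rescaleWordFrom_self {A : Type*} (K : ℕ) (w : TimedWord A) (y : ℝ≥0) :
    rescaleWordFrom K y y w = w := by
  induction w generalizing y with
  | nil => rfl
  | cons p w ih => simp [rescaleWordFrom, rescaleDelay_self, ih]

theorem rescaleWordFrom_rescaleWordFrom {A : Type*} {K : ℕ} {y y' y'' : ℝ≥0}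
    (h : RegionEq K y y') (h' : RegionEq K y' y'') (w : TimedWord A) :
    rescaleWordFrom K y' y'' (rescaleWordFrom K y y' w) = rescaleWordFrom K y y'' w := by
  induction w generalizing y y' y'' with
  | nil => rfl
  | cons p w ih =>
    have h1 := (h.add_rescaleDelay p.1).resetAt
    have h2 := (h'.add_rescaleDelay (rescaleDelay K y y' p.1)).resetAt
    rw [rescaleDelay_rescaleDelay h h'] at h2
    simp [rescaleWordFrom, rescaleDelay_rescaleDelay h h', ih h1 h2]

/-! ### The syntactic equivalence -/

/-- Rescaling back is a two-sided inverse, so the image of the residual can be replaced by a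
preimage and tested word by word. -/
theorem syntacticEquiv_iff {A : Type*} {L : Set (TimedWord A)} {K : ℕ} {u v : TimedWord A} :
    SyntacticEquiv L K u v ↔ RegionEq K (wordClock K u) (wordClock K v) ∧
      ∀ w, u ++ w ∈ L ↔ v ++ rescaleWordFrom K (wordClock K u) (wordClock K v) w ∈ L := by
  refine and_congr_right fun h => ?_
  have hinv : ∀ w : TimedWord A, rescaleWordFrom K (wordClock K u) (wordClock K v)
      (rescaleWordFrom K (wordClock K v) (wordClock K u) w) = w := fun w => by
    rw [rescaleWordFrom_rescaleWordFrom h.symm h, rescaleWordFrom_self]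
  have hinv' : ∀ w : TimedWord A, rescaleWordFrom K (wordClock K v) (wordClock K u)
      (rescaleWordFrom K (wordClock K u) (wordClock K v) w) = w := fun w => by
    rw [rescaleWordFrom_rescaleWordFrom h h.symm, rescaleWordFrom_self]
  rw [funext (rescaleWord_wordClock K u v), Set.image_eq_preimage_of_inverse hinv' hinv, Set.ext_iff]
  constructor
  · intro H w
    have := H (rescaleWordFrom K (wordClock K u) (wordClock K v) w)
    simpa only [Set.mem_preimage, hinv', residual, Set.mem_ofPred_eq] using this
  · intro H w
    have := H (rescaleWordFrom K (wordClock K v) (wordClock K u) w)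
    simpa only [Set.mem_preimage, hinv, residual, Set.mem_ofPred_eq] using this

theorem syntacticEquiv_equivalence {A : Type*} (L : Set (TimedWord A)) (K : ℕ) :
    Equivalence (SyntacticEquiv L K) where
  refl u := syntacticEquiv_iff.2 ⟨.refl _ _, fun w => by rw [rescaleWordFrom_self]⟩
  symm {u v} h := by
    obtain ⟨h1, h2⟩ := syntacticEquiv_iff.1 h
    refine syntacticEquiv_iff.2 ⟨h1.symm, fun w => ?_⟩
    rw [h2, rescaleWordFrom_rescaleWordFrom h1.symm h1, rescaleWordFrom_self]
  trans {u v w} h h' := by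
    obtain ⟨h1, h2⟩ := syntacticEquiv_iff.1 h
    obtain ⟨h1', h2'⟩ := syntacticEquiv_iff.1 h'
    refine syntacticEquiv_iff.2 ⟨h1.trans h1', fun z => ?_⟩
    rw [h2, h2', rescaleWordFrom_rescaleWordFrom h1 h1']

theorem syntacticEquiv_lPreserving {A : Type*} (L : Set (TimedWord A)) (K : ℕ) :
    LPreserving L (SyntacticEquiv L K) := fun u v h => by
  simpa [rescaleWordFrom] using (syntacticEquiv_iff.1 h).2 []

theorem KMonotonic.append_rescaleWordFrom {A : Type*} {K : ℕ}
    {r : TimedWord A → TimedWord A → Prop} (hr : KMonotonic K r) {u v : TimedWord A} (h : r u v)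
    (w : TimedWord A) :
    r (u ++ w) (v ++ rescaleWordFrom K (wordClock K u) (wordClock K v) w) := by
  induction w generalizing u v with
  | nil => simpa [rescaleWordFrom] using h
  | cons p w ih =>
    obtain ⟨t, a⟩ := p
    have h1 := (hr u v h).1
    have h2 := ih ((hr u v h).2 a t _ (h1.add_rescaleDelay t))
    simpa only [wordClock_append_singleton, List.append_assoc, List.singleton_append,
      rescaleWordFrom] using h2

/-- The syntactic equivalence is coarser than every monotonic equivalence that preserves `L`. -/
theorem KMonotonic.syntacticEquiv {A : Type*} {L : Set (TimedWord A)} {K : ℕ}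
    {r : TimedWord A → TimedWord A → Prop} (hr : KMonotonic K r) (hL : LPreserving L r)
    {u v : TimedWord A} (h : r u v) : SyntacticEquiv L K u v :=
  syntacticEquiv_iff.2 ⟨(hr u v h).1, fun w => hL _ _ (hr.append_rescaleWordFrom h w)⟩

/-- No monotonicity is needed when the new delay is the rescaled one: the rescaling of `(t, a) :: w`
continues after its first letter as the rescaling for the new clock values. -/
theorem SyntacticEquiv.append_rescaleDelay {A : Type*} {L : Set (TimedWord A)} {K : ℕ}
    {u v : TimedWord A} (h : SyntacticEquiv L K u v) (t : ℝ≥0) (a : A) :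
    SyntacticEquiv L K (u ++ [(t, a)])
      (v ++ [(rescaleDelay K (wordClock K u) (wordClock K v) t, a)]) := by
  obtain ⟨h1, h2⟩ := syntacticEquiv_iff.1 h
  refine syntacticEquiv_iff.2 ⟨?_, fun w => ?_⟩
  · rw [wordClock_append_singleton, wordClock_append_singleton]
    exact (h1.add_rescaleDelay t).resetAt
  · rw [wordClock_append_singleton, wordClock_append_singleton, List.append_assoc,
      List.append_assoc]
    exact h2 ((t, a) :: w)

/-- The passage from `u` to `v` uses the rescaled delay; the change from that delay to `t'` then
takes place over the single word `v`, where `r` applies by reflexivity. -/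
theorem KMonotonic.kMonotonic_syntacticEquiv {A : Type*} {L : Set (TimedWord A)} {K : ℕ}
    {r : TimedWord A → TimedWord A → Prop} (hr : KMonotonic K r) (hL : LPreserving L r)
    (hrefl : ∀ u, r u u) : KMonotonic K (SyntacticEquiv L K) := by
  refine fun u v h => ⟨h.1, fun a t t' htt => ?_⟩
  refine (syntacticEquiv_equivalence L K).trans (h.append_rescaleDelay t a) ?_
  exact hr.syntacticEquiv hL ((hr v v (hrefl v)).2 a _ t'
    ((h.1.add_rescaleDelay t).symm.trans htt))

theorem finiteIndex_of_finite {S T : Type*} [Finite T] {r : S → S → Prop} (hr : Equivalence r)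
    (f : S → T) (hf : ∀ u v, f u = f v → r u v) : FiniteIndex r := by
  refine Set.Finite.subset (Set.finite_range fun x : T => {s' : S | ∃ s, f s = x ∧ r s s'}) ?_
  rintro _ ⟨s, rfl⟩
  refine ⟨f s, ?_⟩
  ext s'
  exact ⟨fun ⟨z, hz, h⟩ => hr.trans (hf _ _ hz.symm) h, fun h => ⟨s, rfl, h⟩⟩

theorem FiniteIndex.exists_fin {S : Type*} {r : S → S → Prop} (hr : Equivalence r)
    (h : FiniteIndex r) : ∃ (n : ℕ) (cls : S → Fin n), ∀ u v, cls u = cls v ↔ r u v := by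
  have : Finite (Set.range fun s : S => {s' : S | r s s'}) := h
  obtain ⟨n, ⟨e⟩⟩ := Finite.exists_equiv_fin (Set.range fun s : S => {s' : S | r s s'})
  refine ⟨n, fun u => e ⟨_, u, rfl⟩, fun u v => ?_⟩
  rw [e.apply_eq_iff_eq, Subtype.ext_iff]
  change {s' : S | r u s'} = {s' : S | r v s'} ↔ r u v
  constructor
  · intro h
    have : v ∈ {s' : S | r u s'} := by rw [h]; exact hr.refl v
    exact this
  · intro h
    ext s
    exact ⟨fun h' => hr.trans (hr.symm h) h', fun h' => hr.trans h h'⟩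

/-! ### Runs -/

theorem OneTA.run_nil_iff {A : Type*} {B : OneTA A} {q q' : B.State} {x x' : ℝ≥0} :
    B.Run q x [] q' x' ↔ q' = q ∧ x' = x := by
  constructor
  · intro h
    cases h
    exact ⟨rfl, rfl⟩
  · rintro ⟨rfl, rfl⟩
    exact .nil _ _

theorem OneTA.run_cons_iff {A : Type*} {B : OneTA A} {q q' : B.State} {x x' t : ℝ≥0} {a : A}
    {w : TimedWord A} : B.Run q x ((t, a) :: w) q' x' ↔
      ∃ (q₁ : B.State) (φ : OneGuard) (r : Fin 2), (q, q₁, a, φ, r) ∈ B.trans ∧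
        x + t ∈ φ.denote ∧ B.Run q₁ ((r : ℕ) * (x + t)) w q' x' := by
  constructor
  · intro h
    cases h with
    | cons htr hφ hrun => exact ⟨_, _, _, htr, hφ, hrun⟩
  · rintro ⟨q₁, φ, r, htr, hφ, hrun⟩
    exact .cons htr hφ hrun

theorem TA.run_nil_iff {A : Type*} {C : Type} {B : TA A C} {q q' : B.State} {ν ν' : C → ℝ≥0} :
    B.Run q ν [] q' ν' ↔ q' = q ∧ ν' = ν := by
  constructor
  · intro h
    cases h
    exact ⟨rfl, rfl⟩
  · rintro ⟨rfl, rfl⟩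
    exact .nil _ _

theorem TA.run_cons_iff {A : Type*} {C : Type} {B : TA A C} {q q' : B.State} {ν ν' : C → ℝ≥0}
    {t : ℝ≥0} {a : A} {w : TimedWord A} : B.Run q ν ((t, a) :: w) q' ν' ↔
      ∃ (q₁ : B.State) (φ : Guard C) (R : Set C), (q, q₁, a, φ, R) ∈ B.trans ∧
        (fun x => ν x + t) ∈ φ.denote ∧ B.Run q₁ (resetClocks R fun x => ν x + t) w q' ν' := by
  constructor
  · intro h
    cases h with
    | cons htr hφ hrun => exact ⟨_, _, _, htr, hφ, hrun⟩
  · rintro ⟨q₁, φ, R, htr, hφ, hrun⟩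
    exact .cons htr hφ hrun

/-! ### One-clock automata as automata with several clocks -/

/-- A one-clock guard, as a guard over the clock `()`. -/
def OneGuard.toGuard : OneGuard → Guard Unit
  | .lt m => .lt () m
  | .gt m => .gt () m
  | .eq m => .eq () m
  | .and φ ψ => .and φ.toGuard ψ.toGuard

theorem OneGuard.mem_denote_toGuard (φ : OneGuard) (ν : Unit → ℝ≥0) :
    ν ∈ φ.toGuard.denote ↔ ν () ∈ φ.denote := by
  induction φ with
  | lt m => rfl
  | gt m => rfl
  | eq m => rfl
  | and φ ψ ihφ ihψ => exact and_congr ihφ ihψ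

/-- A one-clock automaton, as an automaton over the clock `()`. -/
def OneTA.toTA {A : Type*} (B : OneTA A) : TA A Unit where
  State := B.State
  finite_state := B.finite_state
  init := {B.init}
  trans := (fun p => (p.1, p.2.1, p.2.2.1, p.2.2.2.1.toGuard, {_x | p.2.2.2.2 = 0})) '' B.trans
  finite_trans := B.finite_trans.image _
  final := B.final

theorem resetClocks_unit (r : Fin 2) (ν : Unit → ℝ≥0) :
    resetClocks {_x | r = 0} ν = fun _ => ((r : ℕ) : ℝ≥0) * ν () := by
  funext x
  fin_cases r <;> simp [resetClocks]

theorem OneTA.toTA_run_iff {A : Type*} (B : OneTA A) (w : TimedWord A) (q q' : B.State)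
    (x x' : ℝ≥0) : B.toTA.Run q (fun _ => x) w q' (fun _ => x') ↔ B.Run q x w q' x' := by
  induction w generalizing q x with
  | nil =>
    refine TA.run_nil_iff.trans (Iff.trans ?_ OneTA.run_nil_iff.symm)
    exact and_congr_right fun _ => ⟨fun h => (congrFun h () :), fun h => funext fun _ => h⟩
  | cons p w ih =>
    refine TA.run_cons_iff.trans (Iff.trans ?_ OneTA.run_cons_iff.symm)
    constructor
    · rintro ⟨q₁, _, _, ⟨⟨_, _, _, φ, r⟩, hp, heq⟩, hφ, hrun⟩
      simp only at heq
      obtain ⟨rfl, rfl, rfl, rfl, rfl⟩ := heq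
      rw [resetClocks_unit] at hrun
      exact ⟨q₁, φ, r, hp, (OneGuard.mem_denote_toGuard _ _).1 hφ, (ih _ _).1 hrun⟩
    · rintro ⟨q₁, φ, r, hp, hφ, hrun⟩
      refine ⟨q₁, _, _, ⟨_, hp, rfl⟩, (OneGuard.mem_denote_toGuard _ _).2 hφ, ?_⟩
      rw [resetClocks_unit]
      exact (ih _ _).2 hrun

theorem OneClockIRTADefinable.irtaDefinable {A : Type*} {L : Set (TimedWord A)}
    (h : OneClockIRTADefinable L) : IRTADefinable L := by
  obtain ⟨B, hB, -, rfl⟩ := h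
  refine ⟨Unit, inferInstance, B.toTA, ?_, ?_⟩
  · rintro _ _ _ _ _ ⟨⟨q, q', a, φ, r⟩, hp, heq⟩ hR
    simp only at heq
    obtain ⟨rfl, rfl, rfl, rfl, rfl⟩ := heq
    obtain ⟨-, rfl⟩ := hR
    obtain ⟨m, hm⟩ := hB _ _ _ _ hp
    refine ⟨(), m, fun ν hν => ?_⟩
    have := (OneGuard.mem_denote_toGuard _ _).1 hν
    rwa [hm] at this
  · ext w
    constructor
    · rintro ⟨_, rfl, q, hq, ν, h⟩
      exact ⟨q, hq, ν (), (B.toTA_run_iff _ _ _ _ _).1 h⟩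
    · rintro ⟨q, hq, x, h⟩
      exact ⟨_, rfl, q, hq, fun _ => x, (B.toTA_run_iff _ _ _ _ _).2 h⟩

/-! ### From automata to monotonic equivalences -/

theorem TA.run_append_singleton {A : Type*} {C : Type} {B : TA A C} {u : TimedWord A} {t : ℝ≥0}
    {a : A} {q q' : B.State} {ν ν' : C → ℝ≥0} :
    B.Run q ν (u ++ [(t, a)]) q' ν' ↔ ∃ (q₁ : B.State) (ν₁ : C → ℝ≥0) (φ : Guard C) (R : Set C),
      B.Run q ν u q₁ ν₁ ∧ (q₁, q', a, φ, R) ∈ B.trans ∧ (fun x => ν₁ x + t) ∈ φ.denote ∧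
        ν' = resetClocks R fun x => ν₁ x + t := by
  induction u generalizing q ν with
  | nil =>
    rw [List.nil_append, TA.run_cons_iff]
    constructor
    · rintro ⟨q₁, φ, R, htr, hφ, hrun⟩
      obtain ⟨rfl, rfl⟩ := TA.run_nil_iff.1 hrun
      exact ⟨q, ν, φ, R, .nil _ _, htr, hφ, rfl⟩
    · rintro ⟨q₁, ν₁, φ, R, h, htr, hφ, rfl⟩
      obtain ⟨rfl, rfl⟩ := TA.run_nil_iff.1 h
      exact ⟨q', φ, R, htr, hφ, .nil _ _⟩
  | cons p u ih =>
    constructor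
    · intro h
      obtain ⟨q₂, φ₂, R₂, htr, hφ, hrun⟩ := TA.run_cons_iff.1 h
      obtain ⟨q₁, ν₁, φ, R, h, h'⟩ := ih.1 hrun
      exact ⟨q₁, ν₁, φ, R, .cons htr hφ h, h'⟩
    · rintro ⟨q₁, ν₁, φ, R, h, h'⟩
      obtain ⟨q₂, φ₂, R₂, htr, hφ, hrun⟩ := TA.run_cons_iff.1 h
      exact .cons htr hφ (ih.2 ⟨q₁, ν₁, φ, R, hrun, h'⟩)

/-- The truth of `φ` depends only on the regions of the clock values. -/
def Guard.Regional {C : Type} (K : ℕ) (φ : Guard C) : Prop :=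
  ∀ ν ν' : C → ℝ≥0, (∀ x, RegionEq K (ν x) (ν' x)) → (ν ∈ φ.denote ↔ ν' ∈ φ.denote)

theorem Guard.exists_regional {C : Type} (φ : Guard C) : ∃ K, ∀ K', K ≤ K' → φ.Regional K' := by
  induction φ with
  | tt => exact ⟨0, fun _ _ _ _ _ => Iff.rfl⟩
  | lt x m => exact ⟨m, fun _ hm _ _ h => (h x).lt_iff hm⟩
  | le x m => exact ⟨m, fun _ hm _ _ h => (h x).le_iff hm⟩
  | eq x m => exact ⟨m, fun _ hm _ _ h => (h x).eq_iff hm⟩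
  | ge x m => exact ⟨m, fun _ hm _ _ h => (h x).ge_iff hm⟩
  | gt x m => exact ⟨m, fun _ hm _ _ h => (h x).gt_iff hm⟩
  | and φ ψ ihφ ihψ =>
    obtain ⟨k, hk⟩ := ihφ
    obtain ⟨l, hl⟩ := ihψ
    exact ⟨max k l, fun K' hK ν ν' h => and_congr
      (hk K' ((le_max_left _ _).trans hK) ν ν' h) (hl K' ((le_max_right _ _).trans hK) ν ν' h)⟩

/-- `K` bounds the integers that the transitions of `B` refer to. -/
def TA.BoundedBy {A : Type*} {C : Type} (B : TA A C) (K : ℕ) : Prop :=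
  ∀ (q q' : B.State) (a : A) (φ : Guard C) (R : Set C), (q, q', a, φ, R) ∈ B.trans →
    φ.Regional K ∧ (R.Nonempty → ∃ (x : C) (c : ℕ), c ≤ K ∧ ∀ ν ∈ φ.denote, ν x = c)

theorem TA.IntegerReset.exists_boundedBy {A : Type*} {C : Type} {B : TA A C}
    (hB : B.IntegerReset) : ∃ K, B.BoundedBy K := by
  have h : ∀ p : B.State × B.State × A × Guard C × Set C, ∃ k, p ∈ B.trans → ∀ K, k ≤ K →
      p.2.2.2.1.Regional K ∧ (p.2.2.2.2.Nonempty →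
        ∃ (x : C) (c : ℕ), c ≤ K ∧ ∀ ν ∈ p.2.2.2.1.denote, ν x = c) := by
    rintro ⟨q, q', a, φ, R⟩
    obtain ⟨k, hk⟩ := φ.exists_regional
    by_cases hp : (q, q', a, φ, R) ∈ B.trans ∧ R.Nonempty
    · obtain ⟨x, c, hc⟩ := hB _ _ _ _ _ hp.1 hp.2
      exact ⟨max k c, fun _ K hK => ⟨hk K ((le_max_left _ _).trans hK),
        fun _ => ⟨x, c, (le_max_right _ _).trans hK, hc⟩⟩⟩
    · exact ⟨k, fun hp' K hK => ⟨hk K hK, fun hR => absurd ⟨hp', hR⟩ hp⟩⟩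
  choose k hk using h
  obtain ⟨K, hK⟩ := (B.finite_trans.image k).bddAbove
  exact ⟨K, fun q q' a φ R hp => hk _ hp K (hK ⟨_, hp, rfl⟩)⟩

/-- One transition seen through offsets: `z` stands for `c^K(u) + t` before any reset, and the
clocks are at `z + n x`. The second valuation, in the same region and with the same capped offsets,
can follow the transition and keeps both properties. -/
theorem TA.BoundedBy.step {A : Type*} {C : Type} {B : TA A C} {K : ℕ} (hB : B.BoundedBy K)
    {q q' : B.State} {a : A} {φ : Guard C} {R : Set C} (htr : (q, q', a, φ, R) ∈ B.trans)
    {z z' : ℝ≥0} {n n' : C → ℕ} (hz : RegionEq K z z')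
    (hn : ∀ x, min (n x) (K + 1) = min (n' x) (K + 1)) (hφ : (fun x => z + n x) ∈ φ.denote) :
    (fun x => z' + n' x) ∈ φ.denote ∧ ∃ k k' : C → ℕ,
      (resetClocks R fun x => z + n x) = (fun x => resetAt K z + k x) ∧
      (resetClocks R fun x => z' + n' x) = (fun x => resetAt K z' + k' x) ∧
      ∀ x, min (k x) (K + 1) = min (k' x) (K + 1) := by
  classical
  obtain ⟨hreg, hres⟩ := hB _ _ _ _ _ htr
  refine ⟨(hreg _ _ fun x => hz.add_natCast (hn x)).1 hφ, ?_⟩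
  by_cases hm : ∃ m : ℕ, m ≤ K ∧ z = m
  · obtain ⟨m, hm, hzm⟩ := hm
    have hzm' := (hz.eq_iff hm).1 hzm
    -- Here `c^K` drops from `m` to `0`, so a clock that is not reset gains `m` in its offset.
    refine ⟨fun x => if x ∈ R then 0 else m + n x, fun x => if x ∈ R then 0 else m + n' x,
      ?_, ?_, fun x => ?_⟩
    · funext x
      rw [resetAt_eq_zero hm hzm, hzm]
      by_cases hx : x ∈ R <;> simp [resetClocks, hx]
    · funext x
      rw [resetAt_eq_zero hm hzm', hzm']
      by_cases hx : x ∈ R <;> simp [resetClocks, hx]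
    · have := hn x
      by_cases hx : x ∈ R
      · simp [hx]
      · simp only [hx, if_false]
        omega
  · have hm' : ¬ ∃ m : ℕ, m ≤ K ∧ z' = m := fun ⟨m, h, h'⟩ => hm ⟨m, h, (hz.eq_iff h).2 h'⟩
    -- A reset would force `z + n x = c` with `c ≤ K`, making `z` the integer `c - n x ≤ K`, which
    -- this case excludes.
    have hR : R = ∅ := by
      by_contra hR
      obtain ⟨x, c, hc, hx⟩ := hres (Set.nonempty_iff_ne_empty.2 hR)
      have h1 : z + n x = c := hx _ hφ
      have h2 : n x ≤ c := by
        have : (n x : ℝ≥0) ≤ c := by rw [← h1]; exact le_add_self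
        exact_mod_cast this
      obtain ⟨j, rfl⟩ := Nat.exists_eq_add_of_le' h2
      rw [Nat.cast_add] at h1
      exact hm ⟨j, by omega, add_right_cancel h1⟩
    subst hR
    refine ⟨n, n', ?_, ?_, hn⟩
    · funext x
      rw [resetAt, if_neg hm]
      simp [resetClocks]
    · funext x
      rw [resetAt, if_neg hm']
      simp [resetClocks]

theorem TA.BoundedBy.run_eq {A : Type*} {C : Type} {B : TA A C} {K : ℕ} (hB : B.BoundedBy K)
    {u : TimedWord A} {q q' : B.State} {ν : C → ℝ≥0} (h : B.Run q (fun _ => 0) u q' ν) :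
    ∃ n : C → ℕ, ν = fun x => wordClock K u + n x := by
  induction u using List.reverseRecOn generalizing q' ν with
  | nil =>
    cases h
    exact ⟨fun _ => 0, by simp [wordClock_nil]⟩
  | append_singleton u p ih =>
    obtain ⟨t, a⟩ := p
    obtain ⟨q₁, ν₁, φ, R, hrun, htr, hφ, rfl⟩ := TA.run_append_singleton.1 h
    obtain ⟨n, rfl⟩ := ih hrun
    simp only [add_right_comm] at hφ ⊢
    -- The step is compared with itself, only to obtain the new offsets.
    obtain ⟨-, k, -, hk, -⟩ := hB.step htr (.refl K _) (fun _ => rfl) hφ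
    exact ⟨k, by rw [hk, wordClock_append_singleton]⟩

/-- The states and the capped distances of the clocks to `c^K(u)` that `B` can reach by `u`. -/
def TA.reach {A : Type*} {C : Type} (B : TA A C) (K : ℕ) (u : TimedWord A) :
    Set (B.State × (C → Fin (K + 2))) :=
  {p | ∃ q₀ ∈ B.init, ∃ n : C → ℕ, B.Run q₀ (fun _ => 0) u p.1 (fun x => wordClock K u + n x) ∧
    ∀ x, (p.2 x : ℕ) = min (n x) (K + 1)}

/-- The run over `u` is exchanged for a run over `v` that reaches the same state with the same
capped offsets, possibly from another initial state; the last transition is then copied. -/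
theorem TA.BoundedBy.reach_append_subset {A : Type*} {C : Type} {B : TA A C} {K : ℕ}
    (hB : B.BoundedBy K) {u v : TimedWord A} (h : B.reach K u = B.reach K v) (a : A) {t t' : ℝ≥0}
    (ht : RegionEq K (wordClock K u + t) (wordClock K v + t')) :
    B.reach K (u ++ [(t, a)]) ⊆ B.reach K (v ++ [(t', a)]) := by
  rintro ⟨q, g⟩ ⟨q₀, hq₀, n, hrun, hg⟩
  obtain ⟨q₁, ν₁, φ, R, hrun, htr, hφ, hν⟩ := TA.run_append_singleton.1 hrun
  obtain ⟨n₁, rfl⟩ := hB.run_eq hrun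
  have hmem : (q₁, fun x => (⟨min (n₁ x) (K + 1), by omega⟩ : Fin (K + 2))) ∈ B.reach K u :=
    ⟨q₀, hq₀, n₁, hrun, fun _ => rfl⟩
  rw [h] at hmem
  obtain ⟨q₀', hq₀', n₂, hrun', hn⟩ := hmem
  simp only [add_right_comm] at hφ hν
  obtain ⟨hφ', k, k', hk, hk', hkk⟩ := hB.step htr ht hn hφ
  refine ⟨q₀', hq₀', k', TA.run_append_singleton.2 ⟨q₁, _, φ, R, hrun', htr, ?_, ?_⟩, fun x => ?_⟩
  · simpa only [add_right_comm] using hφ'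
  · rw [wordClock_append_singleton, ← hk']
    simp only [add_right_comm]
  · rw [hk, wordClock_append_singleton] at hν
    have : (n x : ℝ≥0) = k x := add_left_cancel (congrFun hν x)
    rw [hg, ← hkk, Nat.cast_injective this]

theorem TA.BoundedBy.mem_language_iff {A : Type*} {C : Type} {B : TA A C} {K : ℕ}
    (hB : B.BoundedBy K) (u : TimedWord A) :
    u ∈ B.language ↔ ∃ p ∈ B.reach K u, p.1 ∈ B.final := by
  constructor
  · rintro ⟨q₀, hq₀, q, hq, ν, hrun⟩
    obtain ⟨n, rfl⟩ := hB.run_eq hrun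
    exact ⟨(q, fun x => ⟨min (n x) (K + 1), by omega⟩), ⟨q₀, hq₀, n, hrun, fun _ => rfl⟩, hq⟩
  · rintro ⟨p, ⟨q₀, hq₀, n, hrun, -⟩, hp⟩
    exact ⟨q₀, hq₀, p.1, hp, _, hrun⟩

theorem IRTADefinable.exists_kMonotonic {A : Type*} {L : Set (TimedWord A)}
    (h : IRTADefinable L) :
    ∃ K : ℕ, KMonotonic K (SyntacticEquiv L K) ∧ FiniteIndex (SyntacticEquiv L K) := by
  obtain ⟨C, hC, B, hB, rfl⟩ := h
  obtain ⟨K, hK⟩ := hB.exists_boundedBy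
  let r : TimedWord A → TimedWord A → Prop := fun u v =>
    RegionEq K (wordClock K u) (wordClock K v) ∧ B.reach K u = B.reach K v
  have hmono : KMonotonic K r := fun u v huv => by
    refine ⟨huv.1, fun a t t' ht => ⟨?_, ?_⟩⟩
    · rw [wordClock_append_singleton, wordClock_append_singleton]
      exact ht.resetAt
    · exact (hK.reach_append_subset huv.2 a ht).antisymm
        (hK.reach_append_subset huv.2.symm a ht.symm)
  have hL : LPreserving B.language r := fun u v huv => by
    rw [hK.mem_language_iff, hK.mem_language_iff, huv.2]
  refine ⟨K, hmono.kMonotonic_syntacticEquiv hL fun u => ⟨.refl _ _, rfl⟩, ?_⟩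
  have := B.finite_state
  refine finiteIndex_of_finite (syntacticEquiv_equivalence _ _)
    -- The two sets of integers up to `K` record the region of `c^K(u)`, in the sense of
    -- `regionEq_iff`; all three components range over finite types.
    (fun u => (B.reach K u, {m : Fin (K + 1) | wordClock K u < (m : ℕ)},
      {m : Fin (K + 1) | ((m : ℕ) : ℝ≥0) < wordClock K u})) fun u v huv => ?_
  simp only [Prod.mk.injEq, Set.ext_iff, Set.mem_ofPred_eq] at huv
  refine hmono.syntacticEquiv hL ⟨regionEq_iff.2 fun m hm => ?_, Set.ext fun p => ?_⟩
  · exact ⟨huv.2.1 ⟨m, by omega⟩, huv.2.2 ⟨m, by omega⟩⟩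
  · exact huv.1 p

/-! ### From monotonic equivalences to one-clock automata -/

open Classical in
/-- A guard for the region of `z`. -/
def regionGuard (K : ℕ) (z : ℝ≥0) : OneGuard :=
  if (K : ℝ≥0) < z then .gt K
  else if z = ⌊z⌋₊ then .eq ⌊z⌋₊
  else .and (.gt ⌊z⌋₊) (.lt (⌊z⌋₊ + 1))

theorem floor_le_of_not_lt {K : ℕ} {z : ℝ≥0} (h : ¬ (K : ℝ≥0) < z) : ⌊z⌋₊ ≤ K := by
  have := Nat.floor_le_floor (not_lt.1 h)
  rwa [Nat.floor_natCast] at this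

theorem mem_regionGuard {K : ℕ} {z z' : ℝ≥0} :
    z' ∈ (regionGuard K z).denote ↔ RegionEq K z z' := by
  unfold regionGuard
  split_ifs with h1 h2
  · exact ⟨fun h => Or.inr ⟨h1, h⟩, fun h => (h.gt_iff le_rfl).1 h1⟩
  · refine ⟨fun h => ?_, fun h => (h.eq_iff (floor_le_of_not_lt h1)).1 h2⟩
    rw [h2, show z' = ⌊z⌋₊ from h]
    exact .refl _ _
  · have hlt : (⌊z⌋₊ : ℝ≥0) < z := lt_of_le_of_ne (Nat.floor_le zero_le) (Ne.symm h2)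
    constructor
    · rintro ⟨h3, h4⟩
      have h3 : (⌊z⌋₊ : ℝ≥0) < z' := h3
      have h4 : z' < ((⌊z⌋₊ + 1 : ℕ) : ℝ≥0) := h4
      have hfl : ⌊z'⌋₊ = ⌊z⌋₊ :=
        (Nat.floor_eq_iff zero_le).2 ⟨h3.le, by exact_mod_cast h4⟩
      refine Or.inl ⟨hfl.symm, ?_⟩
      rw [fract_eq_zero_iff_eq_floor, fract_eq_zero_iff_eq_floor, hfl]
      exact ⟨fun h => absurd h h2, fun h => absurd h h3.ne'⟩
    · intro h
      -- A non-integer `z ≤ K` lies below an integer that is still at most `K`, so the upper end of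
      -- its interval is visible to `≡^K`.
      have hK : ⌊z⌋₊ + 1 ≤ K := by
        have : (⌊z⌋₊ : ℝ≥0) < K := hlt.trans_le (not_lt.1 h1)
        exact_mod_cast this
      refine ⟨(h.gt_iff (by omega)).1 hlt, (h.lt_iff hK).1 ?_⟩
      push_cast
      exact Nat.lt_floor_add_one z

theorem finite_range_regionGuard (K : ℕ) : (Set.range (regionGuard K)).Finite := by
  refine (((Set.finite_Iic K).image OneGuard.gt).union (((Set.finite_Iic K).image .eq).union
    ((Set.finite_Iic K).image fun m => OneGuard.and (.gt m) (.lt (m + 1))))).subset ?_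
  rintro _ ⟨z, rfl⟩
  unfold regionGuard
  split_ifs with h1 h2
  · exact Or.inl ⟨K, le_refl K, rfl⟩
  · exact Or.inr (Or.inl ⟨_, floor_le_of_not_lt h1, rfl⟩)
  · exact Or.inr (Or.inr ⟨_, floor_le_of_not_lt h1, rfl⟩)

open Classical in
/-- The bit of a transition with guard `regionGuard K z`: the clock is reset at the integers
between `0` and `K`. -/
def resetBit (K : ℕ) (z : ℝ≥0) : Fin 2 :=
  if ∃ m : ℕ, m ≤ K ∧ z = m then 0 else 1

/-- Being an integer at most `K` is a property of the region, so the bit chosen for `z` is right for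
every value that passes the guard of `z`. -/
theorem RegionEq.resetBit_mul {K : ℕ} {z z' : ℝ≥0} (h : RegionEq K z z') :
    ((resetBit K z : ℕ) : ℝ≥0) * z' = IRTA.resetAt K z' := by
  have hiff : (∃ m : ℕ, m ≤ K ∧ z = m) ↔ ∃ m : ℕ, m ≤ K ∧ z' = m :=
    exists_congr fun m => and_congr_right fun hm => h.eq_iff hm
  unfold resetBit IRTA.resetAt
  simp only [hiff]
  split_ifs <;> simp

/-- The automaton whose states are the classes of `≈^{L,K}`. -/
def syntacticTA {A : Type*} [Finite A] (L : Set (TimedWord A)) (K : ℕ) {n : ℕ}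
    (cls : TimedWord A → Fin n) : OneTA A where
  State := Fin n
  finite_state := inferInstance
  init := cls []
  trans := Set.range fun p : TimedWord A × ℝ≥0 × A =>
    (cls p.1, cls (p.1 ++ [(p.2.1, p.2.2)]), p.2.2, regionGuard K (wordClock K p.1 + p.2.1),
      resetBit K (wordClock K p.1 + p.2.1))
  finite_trans := by
    -- The transitions are indexed by an infinite set, but each of their components takes only
    -- finitely many values.
    refine (Set.finite_univ.prod (Set.finite_univ.prod (Set.finite_univ.prod
      ((finite_range_regionGuard K).prod Set.finite_univ)))).subset ?_
    rintro _ ⟨p, rfl⟩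
    exact ⟨trivial, trivial, trivial, ⟨_, rfl⟩, trivial⟩
  final := cls '' L

/-- The clock computes `c^K` and the state the class of the word read so far. Every word thus has
exactly one final configuration, which yields both completeness and the language. -/
theorem syntacticTA_run_iff {A : Type*} [Finite A] {L : Set (TimedWord A)} {K n : ℕ}
    {cls : TimedWord A → Fin n} (hcls : ∀ u v, cls u = cls v ↔ SyntacticEquiv L K u v)
    (hK : KMonotonic K (SyntacticEquiv L K)) (w u : TimedWord A) (q : Fin n) (x : ℝ≥0) :
    (syntacticTA L K cls).Run (cls u) (wordClock K u) w q x ↔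
      q = cls (u ++ w) ∧ x = wordClock K (u ++ w) := by
  induction w generalizing u with
  | nil =>
    rw [List.append_nil]
    exact OneTA.run_nil_iff
  | cons p w ih =>
    obtain ⟨t, a⟩ := p
    have happ : u ++ (t, a) :: w = u ++ [(t, a)] ++ w := by simp
    rw [happ, ← ih]
    refine OneTA.run_cons_iff.trans ⟨?_, ?_⟩
    · rintro ⟨q₁, φ, b, ⟨⟨u', t', a'⟩, heq⟩, hφ, hrun⟩
      have hu : cls u' = cls u := congrArg (fun p => p.1) heq
      obtain rfl : cls (u' ++ [(t', a')]) = q₁ := congrArg (fun p => p.2.1) heq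
      obtain rfl : a' = a := congrArg (fun p => p.2.2.1) heq
      obtain rfl : regionGuard K (wordClock K u' + t') = φ := congrArg (fun p => p.2.2.2.1) heq
      obtain rfl : resetBit K (wordClock K u' + t') = b := congrArg (fun p => p.2.2.2.2) heq
      have hreg := mem_regionGuard.1 hφ
      -- The transition may come from another representative `u'` and another delay `t'`;
      -- monotonicity makes the target class independent of this choice.
      have hcl := (hcls _ _).2 ((hK _ _ ((hcls _ _).1 hu)).2 a' t' t hreg)
      rw [hcl, hreg.resetBit_mul, ← wordClock_append_singleton K u t a'] at hrun
      exact hrun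
    · intro h
      refine ⟨_, _, _, ⟨(u, t, a), rfl⟩, mem_regionGuard.2 (.refl _ _), ?_⟩
      dsimp only
      rw [(RegionEq.refl K _).resetBit_mul, ← wordClock_append_singleton K u t a]
      exact h

theorem syntacticTA_integerReset {A : Type*} [Finite A] (L : Set (TimedWord A)) (K : ℕ) {n : ℕ}
    (cls : TimedWord A → Fin n) : (syntacticTA L K cls).IntegerReset := by
  rintro q q' a φ ⟨⟨u, t, a'⟩, heq⟩
  obtain rfl : regionGuard K (wordClock K u + t) = φ := congrArg (fun p => p.2.2.2.1) heq
  have hr : resetBit K (wordClock K u + t) = 0 := congrArg (fun p => p.2.2.2.2) heq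
  have hm : ∃ m : ℕ, m ≤ K ∧ wordClock K u + t = m := by
    by_contra h
    rw [resetBit, if_neg h] at hr
    exact one_ne_zero hr
  obtain ⟨m, hm, hz⟩ := hm
  refine ⟨m, Set.ext fun z => ?_⟩
  rw [mem_regionGuard, hz, Set.mem_singleton_iff]
  exact ⟨fun h => (h.eq_iff hm).1 rfl, fun h => h ▸ .refl _ _⟩

theorem KMonotonic.oneClockIRTADefinable {A : Type*} [Finite A] {L : Set (TimedWord A)} {K : ℕ}
    (hK : KMonotonic K (SyntacticEquiv L K)) (hfin : FiniteIndex (SyntacticEquiv L K)) :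
    OneClockIRTADefinable L := by
  obtain ⟨n, cls, hcls⟩ := hfin.exists_fin (syntacticEquiv_equivalence L K)
  refine ⟨syntacticTA L K cls, syntacticTA_integerReset L K cls, fun w => ?_, Set.ext fun w => ?_⟩
  · exact ⟨_, _, (syntacticTA_run_iff hcls hK w [] _ _).2 ⟨rfl, rfl⟩⟩
  · constructor
    · rintro ⟨_, ⟨u, hu, rfl⟩, x, h⟩
      have h1 := ((syntacticTA_run_iff hcls hK w [] _ _).1 h).1
      -- A state is final because some `u ∈ L` lies in its class; membership in `L` transfers from
      -- `u` to `w`.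
      exact (syntacticEquiv_lPreserving L K _ _ ((hcls _ _).1 h1)).1 hu
    · intro hw
      exact ⟨cls w, ⟨w, hw, rfl⟩, _, (syntacticTA_run_iff hcls hK w [] _ _).2 ⟨rfl, rfl⟩⟩

end IRTA

end

theorem mainTheorem1 {A : Type*} [Finite A] (L : Set (IRTA.TimedWord A)) :
    (∀ K : ℕ, Equivalence (IRTA.SyntacticEquiv L K)) ∧
    (IRTA.IRTADefinable L ↔
      ∃ K : ℕ, IRTA.KMonotonic K (IRTA.SyntacticEquiv L K) ∧
        IRTA.FiniteIndex (IRTA.SyntacticEquiv L K)) ∧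
    (IRTA.OneClockIRTADefinable L ↔
      ∃ K : ℕ, IRTA.KMonotonic K (IRTA.SyntacticEquiv L K) ∧
        IRTA.FiniteIndex (IRTA.SyntacticEquiv L K)) ∧
    (∀ (K : ℕ) (r : IRTA.TimedWord A → IRTA.TimedWord A → Prop),
      Equivalence r → IRTA.KMonotonic K r → IRTA.LPreserving L r →
        ∀ u v : IRTA.TimedWord A, r u v → IRTA.SyntacticEquiv L K u v) := by
  refine ⟨IRTA.syntacticEquiv_equivalence L, ⟨IRTA.IRTADefinable.exists_kMonotonic, ?_⟩,
    ⟨fun h => h.irtaDefinable.exists_kMonotonic, ?_⟩, ?_⟩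
  · rintro ⟨K, hK, hfin⟩
    exact (hK.oneClockIRTADefinable hfin).irtaDefinable
  · rintro ⟨K, hK, hfin⟩
    exact hK.oneClockIRTADefinable hfin
  · exact fun K r _ hr hL u v h => hr.syntacticEquiv hL h
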